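/- For a probability measure $\mu$ on $\mathbb{R}$ let $\mu^{*n}$, $n\ge 0$, denote its convolution powers ($\mu^{*0}=\delta_0$), and let $\mathscr{C}$ be the set of probability measures $\mu$ on $\mathbb{R}$ with the following property: if $\mu_1$ is any probability measure on $\mathbb{R}$ such that $\mu^{*n}$ and $\mu_1^{*n}$ coincide on $[0,\infty)$ for all $n\ge 0$, then $\mu=\mu_1$. Call $\mu$ downward skip free if its support is included in $\mathbb{Z}$ and $\mu(\{n\})=0$ for all integers $n\le -2$. Theorem. Let $\mu$ be a downward skip free probability measure on $\mathbb{R}$ such that $\mu((0,\infty))>0$ or $\mu=\delta_0$. Then $\mu\in\mathscr{C}$. -/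

import Mathlib

open MeasureTheory

/-- The `n`-fold convolution power `μ^{*n}` of a measure on `ℝ`, with `μ^{*0} = δ₀`. -/
noncomputable def convPow (μ : Measure ℝ) : ℕ → Measure ℝ
  | 0 => Measure.dirac 0
  | n + 1 => Measure.conv (convPow μ n) μ

/-- The class `𝒞` of probability measures on `ℝ` that are determined, among all probability
measures on `ℝ`, by the restrictions to `[0, ∞)` of their convolution powers. -/
def classC : Set (Measure ℝ) :=
  {μ | IsProbabilityMeasure μ ∧
    ∀ μ₁ : Measure ℝ, IsProbabilityMeasure μ₁ →
      (∀ n : ℕ, (convPow μ n).restrict (Set.Ici 0) = (convPow μ₁ n).restrict (Set.Ici 0)) →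
      μ = μ₁}

/-- A measure on `ℝ` is downward skip free if its (topological) support is included in `ℤ` and
it gives no mass to the integers `n ≤ -2`. -/
def IsDownwardSkipFree (μ : Measure ℝ) : Prop :=
  μ.support ⊆ Set.range (fun n : ℤ => (n : ℝ)) ∧ ∀ n : ℤ, n ≤ -2 → μ {(n : ℝ)} = 0

open Set Filter Topology

/-! Only the powers `n = 1, 2` are needed. The first gives `μ` and `μ₁` the same part `ν` on `[0,
∞)` and negative parts of equal mass. On `[m, ∞)` with `m ≥ 0`, equality of the squares then reduces
to equality of the cross terms, the averages of `ν [m - y, ∞)` over the negative parts. That of `μ`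
sits at `-1`, which fixes these averages, and `ae_eq_neg_one_of_lintegral_tail` forces the negative
part of `μ₁` to sit at `-1` too. -/

/-- The mass of a half-line under a convolution, as an integral of tails. -/
lemma conv_apply_Ici (η ν : Measure ℝ) [SFinite ν] (m : ℝ) :
    (Measure.conv η ν) (Ici m) = ∫⁻ y, ν (Ici (m - y)) ∂η := by
  rw [← lintegral_indicator_one measurableSet_Ici,
    Measure.lintegral_conv (measurable_one.indicator measurableSet_Ici)]
  refine lintegral_congr fun y => ?_
  rw [← lintegral_indicator_one measurableSet_Ici]
  refine lintegral_congr fun x => ?_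
  simp only [indicator, mem_Ici, sub_le_iff_le_add, add_comm x y, Pi.one_apply]

lemma measurable_tail (ν : Measure ℝ) (m : ℝ) : Measurable fun y : ℝ => ν (Ici (m - y)) :=
  Monotone.measurable fun _ _ h => measure_mono (Ici_subset_Ici.2 (by linarith))

/-- Finite measures of equal mass concentrated at the same point are equal. -/
lemma measure_eq_of_ae_eq_point {η η₁ : Measure ℝ} {a : ℝ} (h : ∀ᵐ y ∂η, y = a)
    (h₁ : ∀ᵐ y ∂η₁, y = a) (hmass : η univ = η₁ univ) : η = η₁ := by
  ext s _
  by_cases ha : a ∈ s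
  · have e : ∀ {ρ : Measure ℝ}, (∀ᵐ y ∂ρ, y = a) → ρ s = ρ univ := fun hρ =>
      measure_congr (by
        filter_upwards [hρ] with y hy
        subst hy
        exact propext ⟨fun _ => trivial, fun _ => ha⟩)
    rw [e h, e h₁, hmass]
  · have e : ∀ {ρ : Measure ℝ}, (∀ᵐ y ∂ρ, y = a) → ρ s = 0 := fun hρ =>
      measure_eq_zero_iff_ae_notMem.2 (by
        filter_upwards [hρ] with y hy
        exact hy ▸ ha)
    rw [e h, e h₁]

/-- On a half-line `[m, ∞)` with `m ≥ 0`, the square of `μ` only sees its negative part through the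
cross term. -/
lemma conv_self_apply_Ici (μ : Measure ℝ) [IsFiniteMeasure μ] {m : ℝ} (hm : 0 ≤ m) :
    (Measure.conv μ μ) (Ici m) =
      (Measure.conv (μ.restrict (Ici 0)) (μ.restrict (Ici 0))) (Ici m) +
        2 * ∫⁻ y, μ.restrict (Ici 0) (Ici (m - y)) ∂(μ.restrict (Iio 0)) := by
  have hdec : μ.restrict (Ici 0) + μ.restrict (Iio 0) = μ := by
    rw [← compl_Ici]
    exact Measure.restrict_add_restrict_compl measurableSet_Ici
  have hzero : (Measure.conv (μ.restrict (Iio 0)) (μ.restrict (Iio 0))) (Ici m) = 0 := by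
    rw [conv_apply_Ici, lintegral_eq_zero_iff (measurable_tail _ m)]
    filter_upwards [ae_restrict_mem measurableSet_Iio] with y hy
    rw [Measure.restrict_apply measurableSet_Ici]
    have : Ici (m - y) ∩ Iio 0 = ∅ := by
      ext x
      simp only [mem_inter_iff, mem_Ici, mem_Iio, mem_empty_iff_false, iff_false] at hy ⊢
      intro hx
      linarith [hx.1, hx.2]
    simp [this]
  conv_lhs => rw [← hdec]
  rw [Measure.conv_add, Measure.add_conv, Measure.add_conv,
    Measure.conv_comm (μ.restrict (Ici 0)) (μ.restrict (Iio 0))]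
  simp only [Measure.add_apply, hzero, conv_apply_Ici (μ.restrict (Iio 0)) (μ.restrict (Ici 0))]
  ring

lemma convPow_one (μ : Measure ℝ) [SFinite μ] : convPow μ 1 = μ := by
  simp [convPow]

lemma convPow_two (μ : Measure ℝ) [SFinite μ] : convPow μ 2 = Measure.conv μ μ := by
  simp [convPow]

/-- If `ν` lives on the integers and its tails shifted by a random `-y > 0` have on average the mass
of the tails shifted by one, then `y` is almost surely `-1`. -/
lemma ae_eq_neg_one_of_lintegral_tail {ν η : Measure ℝ} [IsFiniteMeasure ν] [IsFiniteMeasure η]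
    (hint : ∀ᵐ x ∂ν, ∃ k : ℤ, (k : ℝ) = x) (hpos : ν (Ioi 0) ≠ 0) (hneg : ∀ᵐ y ∂η, y < 0)
    (h : ∀ m : ℝ, 0 ≤ m → ∫⁻ y, ν (Ici (m - y)) ∂η = ν (Ici (m + 1)) * η univ) :
    ∀ᵐ y ∂η, y = -1 := by
  have hfin : ∀ m : ℝ, ν (Ici (m + 1)) * η univ ≠ ⊤ := fun m =>
    ENNReal.mul_ne_top (measure_ne_top _ _) (measure_ne_top _ _)
  have hnat : ∀ m : ℕ, ∀ y : ℝ, y < 0 → ν (Ici (m - y)) ≤ ν (Ici (m + 1 : ℝ)) := by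
    intro m y hy
    refine measure_mono_ae ?_
    filter_upwards [hint] with x ⟨k, hk⟩ hx
    have hx' : (m : ℝ) - y ≤ x := hx
    change (m + 1 : ℝ) ≤ x
    subst hk
    have : ((m : ℤ) : ℝ) < (k : ℝ) := by push_cast; linarith
    have := Int.cast_lt.1 this
    exact_mod_cast (show (m : ℤ) + 1 ≤ k by omega)
  -- The pointwise bound `hnat` has equal finite integrals on both sides, so it is an equality
  -- almost everywhere.
  have hnat_eq : ∀ᵐ y ∂η, ∀ m : ℕ, ν (Ici (m - y)) = ν (Ici (m + 1 : ℝ)) := by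
    refine ae_all_iff.2 fun m => ?_
    refine ae_eq_of_ae_le_of_lintegral_le (hneg.mono fun y hy => hnat m y hy) ?_
      aemeasurable_const ?_
    · rw [h m m.cast_nonneg]; exact hfin m
    · rw [h m m.cast_nonneg, lintegral_const]
  have hge : ∀ᵐ y ∂η, -1 ≤ y := by
    filter_upwards [hnat_eq] with y hy
    by_contra! hlt
    -- If `y < -1`, an integer `≥ m - y` is at least `m + 2`, so the tails of `ν` from `1` on never
    -- decrease; yet they tend to `0`.
    have hstep : ∀ m : ℕ, ν (Ici (m + 1 : ℝ)) ≤ ν (Ici ((m + 1 : ℕ) + 1 : ℝ)) := by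
      intro m
      rw [← hy m]
      refine measure_mono_ae ?_
      filter_upwards [hint] with x ⟨k, hk⟩ hx
      have hx' : (m : ℝ) - y ≤ x := hx
      change ((m + 1 : ℕ) + 1 : ℝ) ≤ x
      subst hk
      have : ((m + 1 : ℤ) : ℝ) < (k : ℝ) := by push_cast; linarith
      have := Int.cast_lt.1 this
      exact_mod_cast (show (m : ℤ) + 1 + 1 ≤ k by omega)
    have hle : ∀ m : ℕ, ν (Ici (1 : ℝ)) ≤ ν (Ici (m + 1 : ℝ)) := by
      intro m
      induction m with
      | zero => simp
      | succ m ih => exact ih.trans (hstep m)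
    have hlim : Tendsto (fun m : ℕ => ν (Ici (m + 1 : ℝ))) atTop
        (𝓝 (ν (⋂ m : ℕ, Ici (m + 1 : ℝ)))) :=
      tendsto_measure_iInter_atTop (fun m => measurableSet_Ici.nullMeasurableSet)
        (fun a b hab => Ici_subset_Ici.2 (by
          have : (a : ℝ) ≤ b := Nat.cast_le.2 hab
          linarith)) ⟨0, measure_ne_top _ _⟩
    have hempty : (⋂ m : ℕ, Ici (m + 1 : ℝ)) = ∅ := by
      ext x
      simp only [mem_iInter, mem_Ici, mem_empty_iff_false, iff_false, not_forall, not_le]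
      obtain ⟨n, hn⟩ := exists_nat_gt x
      exact ⟨n, by linarith⟩
    rw [hempty, measure_empty] at hlim
    have hzero : ν (Ici (1 : ℝ)) ≤ 0 := ge_of_tendsto' hlim hle
    refine hpos (le_antisymm (le_trans (measure_mono_ae ?_) hzero) bot_le)
    filter_upwards [hint] with x ⟨k, hk⟩ hx
    have hx' : 0 < x := hx
    change (1 : ℝ) ≤ x
    subst hk
    have := Int.cast_pos.1 hx'
    exact_mod_cast (show (1 : ℤ) ≤ k by omega)
  obtain ⟨K, hK, hKν⟩ : ∃ K : ℤ, 0 < K ∧ ν {(K : ℝ)} ≠ 0 := by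
    by_contra! hcon
    refine hpos (measure_eq_zero_iff_ae_notMem.2 ?_)
    have : ∀ᵐ x ∂ν, ∀ K : ℤ, 0 < K → x ≠ (K : ℝ) := by
      refine ae_all_iff.2 fun K => ?_
      by_cases hK : 0 < K
      · filter_upwards [measure_eq_zero_iff_ae_notMem.1 (hcon K hK)] with x hx _ using hx
      · exact ae_of_all _ fun _ h => absurd h hK
    filter_upwards [hint, this] with x ⟨k, hk⟩ hx hx0
    subst hk
    exact hx k (Int.cast_pos.1 (mem_Ioi.1 hx0)) rfl
  -- Now `y ≥ -1` reverses the bound and makes it valid for non-integer `m`; rationals keep the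
  -- exceptional sets countable in number.
  have hrat_eq : ∀ᵐ y ∂η, ∀ m : ℚ, 0 ≤ m → ν (Ici ((m : ℝ) - y)) = ν (Ici (m + 1 : ℝ)) := by
    refine ae_all_iff.2 fun m => ?_
    by_cases hm : 0 ≤ m
    · have hm' : (0 : ℝ) ≤ m := Rat.cast_nonneg.2 hm
      have : (fun _ => ν (Ici (m + 1 : ℝ))) =ᵐ[η] fun y => ν (Ici ((m : ℝ) - y)) := by
        refine ae_eq_of_ae_le_of_lintegral_le ?_ ?_ (measurable_tail ν m).aemeasurable ?_
        · filter_upwards [hge] with y hy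
          exact measure_mono (Ici_subset_Ici.2 (by linarith))
        · rw [lintegral_const]; exact hfin m
        · rw [h m hm', lintegral_const]
      filter_upwards [this] with y hy _ using hy.symm
    · exact ae_of_all _ fun _ h => absurd h hm
  filter_upwards [hneg, hge, hrat_eq] with y hy0 hy1 hy
  by_contra hne
  have hlt : -1 < y := lt_of_le_of_ne hy1 (Ne.symm hne)
  -- This `m` satisfies `m - y < K < m + 1`, so the two equal tails would differ by at least the
  -- atom at `K`.
  obtain ⟨m, hm1, hm2⟩ := exists_rat_btwn (show (K : ℝ) - 1 < K + y by linarith)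
  have hK1 : (1 : ℝ) ≤ K := by exact_mod_cast (show (1 : ℤ) ≤ K by omega)
  have hm0 : (0 : ℚ) ≤ m := by
    have : (0 : ℝ) ≤ m := by linarith
    exact_mod_cast this
  have hlow : ν (Ici (K : ℝ)) ≤ ν (Ioi (K : ℝ)) := by
    calc ν (Ici (K : ℝ)) ≤ ν (Ici ((m : ℝ) - y)) :=
          measure_mono (Ici_subset_Ici.2 (by linarith))
      _ = ν (Ici (m + 1 : ℝ)) := hy m hm0
      _ ≤ ν (Ioi (K : ℝ)) := measure_mono (Ici_subset_Ioi.2 (by linarith))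
  have hsplit : ν (Ici (K : ℝ)) = ν (Ioi (K : ℝ)) + ν {(K : ℝ)} := by
    rw [← Ioi_union_left, measure_union (by simp) (measurableSet_singleton _)]
  rw [hsplit] at hlow
  refine hKν (le_antisymm ?_ bot_le)
  exact (ENNReal.add_le_add_iff_left (measure_ne_top ν (Ioi (K : ℝ)))).1 (by simpa using hlow)

theorem theorem8733 (μ : Measure ℝ) [IsProbabilityMeasure μ]
    (hμ : IsDownwardSkipFree μ)
    (hpos : μ (Set.Ioi 0) ≠ 0 ∨ μ = Measure.dirac 0) :
    μ ∈ classC := by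
  refine ⟨inferInstance, fun μ₁ _ hconv => ?_⟩
  have hdec : ∀ ρ : Measure ℝ, ρ.restrict (Ici 0) + ρ.restrict (Iio 0) = ρ := fun ρ => by
    rw [← compl_Ici]
    exact Measure.restrict_add_restrict_compl measurableSet_Ici
  have hν : μ.restrict (Ici 0) = μ₁.restrict (Ici 0) := by
    simpa only [convPow_one] using hconv 1
  have hmass : μ.restrict (Iio 0) univ = μ₁.restrict (Iio 0) univ := by
    have h0 : μ (Ici 0) = μ₁ (Ici 0) := by
      simpa using congrArg (fun ρ : Measure ℝ => ρ univ) hν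
    rw [Measure.restrict_apply_univ, Measure.restrict_apply_univ, ← compl_Ici,
      prob_compl_eq_one_sub measurableSet_Ici, prob_compl_eq_one_sub measurableSet_Ici, h0]
  suffices hη : μ.restrict (Iio 0) = μ₁.restrict (Iio 0) by
    rw [← hdec μ, ← hdec μ₁, hν, hη]
  rcases hpos with hpos | rfl
  · have hint : ∀ᵐ x ∂μ, ∃ k : ℤ, (k : ℝ) = x := by
      filter_upwards [Measure.support_mem_ae (μ := μ)] with x hx using hμ.1 hx
    have hη : ∀ᵐ y ∂μ.restrict (Iio 0), y = -1 := by
      have hne : ∀ᵐ y ∂μ, ∀ k : ℤ, k ≤ -2 → y ≠ (k : ℝ) := by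
        refine ae_all_iff.2 fun k => ?_
        by_cases hk : k ≤ -2
        · filter_upwards [measure_eq_zero_iff_ae_notMem.1 (hμ.2 k hk)] with x hx _ using hx
        · exact ae_of_all _ fun _ h => absurd h hk
      filter_upwards [ae_restrict_mem measurableSet_Iio, ae_restrict_of_ae hint,
        ae_restrict_of_ae hne] with y hy ⟨k, hk⟩ hyk
      subst hk
      have hk0 : k < 0 := Int.cast_lt_zero.1 (mem_Iio.1 hy)
      have hk2 : ¬ k ≤ -2 := fun h => hyk k h rfl
      have : k = -1 := by omega
      simp [this]
    refine measure_eq_of_ae_eq_point hη ?_ hmass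
    refine ae_eq_neg_one_of_lintegral_tail (ν := μ.restrict (Ici 0)) (ae_restrict_of_ae hint) ?_
      (ae_restrict_mem measurableSet_Iio) fun m hm => ?_
    · rwa [Measure.restrict_apply measurableSet_Ioi,
        inter_eq_left.2 Ioi_subset_Ici_self]
    · have hsq : (Measure.conv μ μ) (Ici m) = (Measure.conv μ₁ μ₁) (Ici m) := by
        have h2 := congrArg (fun ρ : Measure ℝ => ρ (Ici m)) (hconv 2)
        simpa only [convPow_two, Measure.restrict_apply measurableSet_Ici,
          inter_eq_left.2 (Ici_subset_Ici.2 hm)] using h2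
      rw [conv_self_apply_Ici μ hm, conv_self_apply_Ici μ₁ hm, ← hν,
        ENNReal.add_right_inj (measure_ne_top _ _),
        ENNReal.mul_right_inj (by simp) (by simp)] at hsq
      rw [← hsq, ← hmass, ← lintegral_const]
      refine lintegral_congr_ae ?_
      filter_upwards [hη] with y hy
      rw [hy, sub_neg_eq_add]
  -- For `δ₀` the negative parts have mass zero.
  · have h0 : (Measure.dirac (0 : ℝ)).restrict (Iio 0) univ = 0 := by simp
    rw [Measure.measure_univ_eq_zero.1 h0, Measure.measure_univ_eq_zero.1 (hmass.symm.trans h0)]
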